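/- Let $(\mathcal Z,\mathcal A)$ be a measurable space, let $Z_1,Z_2,\dots$ be i.i.d. $\mathcal Z$-valued random variables on a probability space, and let $Z$ be a further random variable (the test point) with the same distribution, independent of the sequence $(Z_t)_{t\ge1}$. Let $R:\mathcal Z\to\mathbb R$ be a fixed measurable function and let $\alpha,\delta\in(0,1)$. For $t\ge 1$ put $\widehat F_t(r)=\frac1t\sum_{i=1}^t \mathbf 1\{R(Z_i)\le r\}$ and $$\ell_t=\frac{1.4\,\log\log(2.1\,t)+\log(10/\delta)}{t},\qquad u_t=1.5\sqrt{\alpha(1-\alpha)\,\ell_t}+0.8\,\ell_t,$$ $$\widehat q_t=\inf\{r\in\mathbb R:\ \widehat F_t(r)\ge 1-\alpha+u_t\}\in[-\infty,\infty]\quad(\inf\emptyset=+\infty),\qquad \widehat C_t=\{x\in\mathcal Z:\ R(x)\le\widehat q_t\}.$$ Then the prediction sets $\widehat C_1,\widehat C_2,\dots$ are $(\alpha,\delta)$-TUPAC (time-uniform probably approximately correct): for every random time $T$ with values in $\{1,2,\dots\}$ (which may depend on the whole sequence $(Z_t)_{t\ge1}$ and on further randomness, and need not be a stopping time) such that $Z$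 is independent of the pair $((Z_t)_{t\ge1},T)$, $$\mathbb P\Big\{\mathbb P\big(Z\in\widehat C_T\,\big|\,Z_1,\dots,Z_T\big)\ge 1-\alpha\Big\}\ \ge\ 1-\delta,$$ where the inner probability is conditional on the random-length vector $(Z_1,\dots,Z_T)$ (so also on its length $T$). -/

import Mathlib

open MeasureTheory ProbabilityTheory

namespace SplitTUPAC

/-- `ℓ_t = (1.4 log log (2.1 t) + log (10 / δ)) / t`, used for `t ≥ 1` only. -/
noncomputable def ell (δ : ℝ) (t : ℕ) : ℝ :=
  (1.4 * Real.log (Real.log (2.1 * (t : ℝ))) + Real.log (10 / δ)) / (t : ℝ)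

/-- `u_t = 1.5 √(α (1 - α) ℓ_t) + 0.8 ℓ_t`. -/
noncomputable def u (α δ : ℝ) (t : ℕ) : ℝ :=
  1.5 * Real.sqrt (α * (1 - α) * ell δ t) + 0.8 * ell δ t

variable {𝒵 : Type*}

/-- The empirical distribution function `F̂_t(r)` of the scores `R(Z_1), …, R(Z_t)`; the vector
`z` holds the first `t` observations. -/
noncomputable def empCDF (R : 𝒵 → ℝ) (t : ℕ) (z : Fin t → 𝒵) (r : ℝ) : ℝ :=
  (∑ i : Fin t, Set.indicator {x : 𝒵 | R x ≤ r} (fun _ => (1 : ℝ)) (z i)) / (t : ℝ)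

/-- `q̂_t = inf {r ∈ ℝ : F̂_t(r) ≥ 1 - α + u_t}`, an extended real number: it is `+∞` if no real
`r` qualifies, that is, if `1 - α + u_t > 1`. -/
noncomputable def qHat (α δ : ℝ) (R : 𝒵 → ℝ) (t : ℕ) (z : Fin t → 𝒵) : EReal :=
  sInf ((fun r : ℝ => (r : EReal)) '' {r : ℝ | 1 - α + u α δ t ≤ empCDF R t z r})

/-- The set `Ĉ_t = {x : R x ≤ q̂_t}` that the split algorithm reports at time `t`, as a function
of the first `t` observations. -/
def predSet (α δ : ℝ) (R : 𝒵 → ℝ) (t : ℕ) (z : Fin t → 𝒵) : Set 𝒵 :=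
  {x : 𝒵 | (R x : EReal) ≤ qHat α δ R t z}

variable {Ω : Type*}

/-- The observations `Z_1, …, Z_T` up to the random time `T`, a vector of random length. The
stream is indexed from `0` here: `Z i` is the observation number `i + 1`. -/
def observed (Z : ℕ → Ω → 𝒵) (T : Ω → ℕ) (ω : Ω) : Σ t : ℕ, (Fin t → 𝒵) :=
  ⟨T ω, fun i => Z i ω⟩

/-- A rule `C`, which maps the first `t` observations to a prediction set `Ĉ_t`, is
`(α, δ)`-TUPAC for the stream `Z` and the test point `Ztest`: for every random time `T ≥ 1`,
`P (P (Ztest ∈ Ĉ_T | Z_1, …, Z_T) ≥ 1 - α) ≥ 1 - δ`.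
The time `T` may depend on the whole stream and on further randomness, but not on the test point:
the latter is independent of the stream and `T` taken together. -/
def IsTUPAC [MeasurableSpace Ω] [MeasurableSpace 𝒵] (P : Measure Ω) (Z : ℕ → Ω → 𝒵)
    (Ztest : Ω → 𝒵) (C : (t : ℕ) → (Fin t → 𝒵) → Set 𝒵) (α δ : ℝ) : Prop :=
  ∀ T : Ω → ℕ, Measurable T → (∀ ω, 1 ≤ T ω) →
    IndepFun Ztest (fun ω => ((fun i : ℕ => Z i ω), T ω)) P →
    1 - δ ≤ P.real {ω : Ω | 1 - α ≤
      (P[Set.indicator {ω' : Ω | Ztest ω' ∈ C (T ω') (fun i => Z i ω')} (fun _ => (1 : ℝ)) |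
        MeasurableSpace.comap (observed Z T) inferInstance]) ω}

end SplitTUPAC

/-! Let `q₀` be a `(1 - α)`-quantile of the score law, so that P(R < q₀) ≤ 1 - α ≤ P(R ≤ q₀). If at
every `t` the empirical frequency of {R < q₀} is below 1 - α + u_t, then every q̂_t is at least `q₀`
(`le_qHat_of_hits_lt`). This good event does not involve `T`, so no stopping-time property is
needed. On it, independence of the test point makes the conditional coverage at time `T` at least
P(R ≤ q₀) (`coverage_le_condExp`).

It remains to bound the probability of ever crossing by `δ` (`measure_exists_crossing_le`). Time is
cut into epochs 4^k ≤ t ≤ 4^(k+1). In each, Ville's inequality is applied to an exponential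
martingale whose single exponent suits the whole epoch (`exists_exponent`). The failure
probabilities, of order (k+1)^(-1.4), sum to at most `δ`. -/

namespace SplitTUPAC

/-! ### Bernstein bound for Bernoulli variables. -/

lemma exp_mul_cubic_le_one {x : ℝ} (hx : 0 ≤ x) :
    Real.exp x * (1 - x + x ^ 2 / 2 - x ^ 3 / 6) ≤ 1 := by
  have hd : ∀ y : ℝ, HasDerivAt (fun y => Real.exp y * (1 - y + y ^ 2 / 2 - y ^ 3 / 6))
      (Real.exp y * (-(y ^ 3 / 6))) y := by
    intro y
    have h1 := ((((hasDerivAt_const y (1 : ℝ)).sub (hasDerivAt_id y)).add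
      ((hasDerivAt_pow 2 y).div_const 2)).sub ((hasDerivAt_pow 3 y).div_const 6))
    refine ((Real.hasDerivAt_exp y).mul h1).congr_deriv ?_
    simp only [Pi.add_apply, Pi.sub_apply, id_eq]
    norm_num
    ring
  have hanti : AntitoneOn (fun y => Real.exp y * (1 - y + y ^ 2 / 2 - y ^ 3 / 6))
      (Set.Ici (0 : ℝ)) := by
    refine antitoneOn_of_deriv_nonpos (convex_Ici 0)
      (fun y _ => (hd y).continuousAt.continuousWithinAt)
      (fun y _ => (hd y).differentiableAt.differentiableWithinAt) fun y hy => ?_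
    rw [interior_Ici] at hy
    have hy' : 0 < y := hy
    rw [(hd y).deriv]
    have : 0 ≤ Real.exp y * (y ^ 3 / 6) := by positivity
    linarith
  simpa using hanti (Set.mem_Ici.2 le_rfl) (Set.mem_Ici.2 hx) hx

/-- Multiply by the cubic Taylor polynomial of exp(-x), positive in this range. After clearing
denominators the surplus is x³(7/15 - 11x/30 + x²/10), whose quadratic factor has negative
discriminant. -/
lemma exp_le_of_nonneg {x : ℝ} (h0 : 0 ≤ x) (h1 : x < 5 / 4) :
    Real.exp x ≤ 1 + x + x ^ 2 / (2 * (1 - 0.8 * x)) := by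
  have hb : 0 < 1 - 0.8 * x := by norm_num; linarith
  have hpos : 0 < 1 - x + x ^ 2 / 2 - x ^ 3 / 6 := by
    nlinarith [sq_nonneg (x - 1), mul_nonneg h0 h0, mul_nonneg (mul_nonneg h0 h0) h0,
      mul_nonneg (mul_nonneg h0 h0) (sub_nonneg.2 h1.le)]
  have h := exp_mul_cubic_le_one h0
  have h2 : 1 ≤ (1 + x + x ^ 2 / (2 * (1 - 0.8 * x))) * (1 - x + x ^ 2 / 2 - x ^ 3 / 6) := by
    have : 1 + x + x ^ 2 / (2 * (1 - 0.8 * x)) =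
        (2 * (1 + x) * (1 - 0.8 * x) + x ^ 2) / (2 * (1 - 0.8 * x)) := by
      rw [eq_div_iff (by linarith), add_mul, div_mul_cancel₀ _ (by linarith)]
      ring
    rw [this, div_mul_eq_mul_div, le_div_iff₀ (by linarith)]
    have hx3 : 0 ≤ x ^ 3 := by positivity
    have hq : 0 ≤ 7 / 15 - 11 / 30 * x + x ^ 2 / 10 := by nlinarith [sq_nonneg (x - 11 / 6)]
    have := mul_nonneg hx3 hq
    norm_num
    nlinarith [this]
  exact le_of_mul_le_mul_right (h.trans h2) hpos

lemma exp_neg_le {x : ℝ} (h0 : 0 ≤ x) : Real.exp (-x) ≤ 1 - x + x ^ 2 / 2 := by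
  have h := Real.quadratic_le_exp_of_nonneg h0
  have hp : 0 < 1 - x + x ^ 2 / 2 := by nlinarith [sq_nonneg (x - 1)]
  rw [Real.exp_neg, inv_le_iff_one_le_mul₀ (Real.exp_pos x)]
  calc (1 : ℝ) ≤ (1 - x + x ^ 2 / 2) * (1 + x + x ^ 2 / 2) := by nlinarith [sq_nonneg (x ^ 2)]
    _ ≤ _ := by gcongr

/-- A Bernstein bound for the moment generating function of a Bernoulli variable. -/
lemma bernoulli_mgf_le {q l : ℝ} (hq0 : 0 ≤ q) (hq1 : q ≤ 1) (hl0 : 0 ≤ l) (hl1 : l < 5 / 4) :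
    1 - q + q * Real.exp l ≤
      Real.exp (l * q + (1 - q) * q * (l ^ 2 / (2 * (1 - 0.8 * l)))) := by
  have hb : 0 < 1 - 0.8 * l := by norm_num; linarith
  set G : ℝ := 1 / (2 * (1 - 0.8 * l)) with hG
  have hGhalf : 1 / 2 ≤ G := by
    rw [hG]
    apply one_div_le_one_div_of_le (by linarith)
    norm_num; linarith
  have e1 : Real.exp (l * (1 - q)) ≤ 1 + l * (1 - q) + (l * (1 - q)) ^ 2 * G := by
    have hle : l * (1 - q) ≤ l := by nlinarith
    have h0 : 0 ≤ l * (1 - q) := mul_nonneg hl0 (by linarith)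
    refine (exp_le_of_nonneg h0 (by linarith)).trans ?_
    rw [div_eq_mul_one_div]
    have : 1 / (2 * (1 - 0.8 * (l * (1 - q)))) ≤ G := by
      rw [hG]
      apply one_div_le_one_div_of_le (by linarith)
      norm_num; linarith
    gcongr
  have e2 : Real.exp (-(l * q)) ≤ 1 - l * q + (l * q) ^ 2 * G := by
    refine (exp_neg_le (mul_nonneg hl0 hq0)).trans ?_
    nlinarith [sq_nonneg (l * q)]
  -- The variable is centred: its values are 1 - q and -q, and q(1-q)² + (1-q)q² = q(1-q) yields the
  -- variance factor.
  have key : (1 - q + q * Real.exp l) * Real.exp (-(l * q)) ≤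
      Real.exp ((1 - q) * q * (l ^ 2 / (2 * (1 - 0.8 * l)))) := by
    have h1 : (1 - q + q * Real.exp l) * Real.exp (-(l * q)) =
        (1 - q) * Real.exp (-(l * q)) + q * Real.exp (l * (1 - q)) := by
      rw [show l * (1 - q) = l + -(l * q) by ring, Real.exp_add]; ring
    rw [h1]
    have h2 := Real.add_one_le_exp ((1 - q) * q * (l ^ 2 / (2 * (1 - 0.8 * l))))
    rw [div_eq_mul_one_div, ← hG] at h2 ⊢
    have h3 := mul_le_mul_of_nonneg_left e1 hq0
    have h4 := mul_le_mul_of_nonneg_left e2 (sub_nonneg.2 hq1)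
    nlinarith
  rw [Real.exp_add]
  rw [Real.exp_neg, ← div_eq_mul_inv, div_le_iff₀ (Real.exp_pos _)] at key
  linarith

/-! ### Epoch stitching: exponents, costs and their sum. -/

/-- One exponent `1 / (a + 0.8)` serves the whole range of scales `r * a` with `1 ≤ r ≤ 2`. -/
lemma exists_exponent {v x m : ℝ} (hv : 0 < v) (hx : 0 < x) (hm : 0 < m) :
    ∃ l : ℝ, 0 < l ∧ l < 5 / 4 ∧ ∀ t : ℝ, m ≤ t → t ≤ 4 * m →
      x + t * (v * (l ^ 2 / (2 * (1 - 0.8 * l)))) ≤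
        l * (1.5 * Real.sqrt (v * t * x) + 0.8 * x) := by
  set a := Real.sqrt (v * m / x) with ha
  have ha0 : 0 < a := Real.sqrt_pos.2 (by positivity)
  have ha2 : a ^ 2 = v * m / x := Real.sq_sqrt (by positivity)
  refine ⟨1 / (a + 0.8), by positivity, ?_, fun t ht1 ht2 => ?_⟩
  · rw [div_lt_div_iff₀ (by positivity) (by norm_num)]; norm_num; linarith
  set r := Real.sqrt (t / m) with hr
  have htm : 1 ≤ t / m := (one_le_div hm).2 ht1
  have hr1 : 1 ≤ r := Real.one_le_sqrt.2 htm
  have hr2 : r ≤ 2 := Real.sqrt_le_iff.2 ⟨by norm_num, by rw [div_le_iff₀ hm]; linarith⟩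
  have hrs : r ^ 2 = t / m := Real.sq_sqrt (by linarith)
  have hs : Real.sqrt (v * t * x) = r * a * x := by
    have : v * t * x = (r * a * x) ^ 2 := by
      rw [mul_pow, mul_pow, hrs, ha2]; field_simp
    rw [this, Real.sqrt_sq (by positivity)]
  have htv : t * v = r ^ 2 * a ^ 2 * x := by rw [hrs, ha2]; field_simp
  have hpsi : (1 / (a + 0.8)) ^ 2 / (2 * (1 - 0.8 * (1 / (a + 0.8)))) =
      1 / (2 * a * (a + 0.8)) := by
    have : 1 - 0.8 * (1 / (a + 0.8)) = a / (a + 0.8) := by field_simp; ring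
    rw [this]; field_simp
  rw [hs, hpsi, ← mul_assoc, htv]
  have : r ^ 2 * a ^ 2 * x * (1 / (2 * a * (a + 0.8))) =
      1 / (a + 0.8) * (r ^ 2 * a * x / 2) := by field_simp
  rw [this]
  have hx' : x = 1 / (a + 0.8) * ((a + 0.8) * x) := by field_simp
  nth_rewrite 1 [hx']
  rw [← mul_add]
  refine mul_le_mul_of_nonneg_left ?_ (by positivity)
  -- The claim reduces to 1 + r²/2 ≤ 1.5 r, that is (r - 1)(2 - r) ≥ 0. Hence the factor 1.5 pairs
  -- with epochs of ratio 4.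
  have : 0 ≤ a * x * ((r - 1) * (2 - r)) :=
    mul_nonneg (by positivity) (mul_nonneg (by linarith) (by linarith))
  norm_num
  nlinarith

/-- The logarithmic cost of the epoch `4 ^ k ≤ t < 4 ^ (k + 1)`. -/
noncomputable def epochCost (δ : ℝ) (k : ℕ) : ℝ :=
  1.4 * Real.log ((k + 1) * Real.log 2) + Real.log (10 / δ)

lemma exp_neg_epochCost {δ : ℝ} (hδ : 0 < δ) (k : ℕ) :
    Real.exp (-epochCost δ k) =
      δ / 10 * (Real.log 2) ^ (-1.4 : ℝ) * ((k : ℝ) + 1) ^ (-1.4 : ℝ) := by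
  have h2 : 0 < Real.log 2 := Real.log_pos (by norm_num)
  have hk : (0 : ℝ) < k + 1 := by positivity
  rw [epochCost, neg_add, Real.exp_add, mul_assoc, ← Real.mul_rpow h2.le hk.le,
    Real.rpow_def_of_pos (by positivity), ← Real.log_inv, Real.exp_log (by positivity), inv_div,
    mul_comm (Real.log 2)]
  rw [mul_comm]
  congr 2
  ring

/-- Discrete form of comparing x^(-1.4) with its integral; 2.5 = 1/0.4. -/
lemma rpow_telescope (k : ℕ) :
    ((k : ℝ) + 2) ^ (-1.4 : ℝ) ≤
      2.5 * (((k : ℝ) + 1) ^ (-0.4 : ℝ) - ((k : ℝ) + 2) ^ (-0.4 : ℝ)) := by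
  have h1 : (0 : ℝ) < k + 1 := by positivity
  have h2 : (0 : ℝ) < k + 2 := by positivity
  have e1 : ((k : ℝ) + 2) ^ (-1.4 : ℝ) = ((k : ℝ) + 2) ^ (-0.4 : ℝ) * (1 / (k + 2)) := by
    rw [show (-1.4 : ℝ) = -0.4 + -1 by norm_num, Real.rpow_add h2, Real.rpow_neg_one, one_div]
  have e2 : ((k : ℝ) + 1) ^ (-0.4 : ℝ) =
      ((k : ℝ) + 2) ^ (-0.4 : ℝ) * (((k : ℝ) + 1) / (k + 2)) ^ (-0.4 : ℝ) := by
    rw [← Real.mul_rpow h2.le (by positivity)]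
    congr 1
    field_simp
  have hl : Real.log (((k : ℝ) + 1) / (k + 2)) ≤ -(1 / (k + 2)) := by
    refine (Real.log_le_sub_one_of_pos (by positivity)).trans (le_of_eq ?_)
    field_simp
    ring
  have e3 : 1 + 0.4 * (1 / ((k : ℝ) + 2)) ≤ (((k : ℝ) + 1) / (k + 2)) ^ (-0.4 : ℝ) := by
    rw [Real.rpow_def_of_pos (by positivity)]
    have := Real.add_one_le_exp (Real.log (((k : ℝ) + 1) / (k + 2)) * (-0.4))
    norm_num at this hl ⊢
    linarith
  rw [e1, e2]
  have h3 : 0 ≤ ((k : ℝ) + 2) ^ (-0.4 : ℝ) := by positivity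
  norm_num at e3 ⊢
  nlinarith

lemma sum_rpow_le (n : ℕ) :
    ∑ k ∈ Finset.range n, ((k : ℝ) + 1) ^ (-1.4 : ℝ) ≤ 3.5 := by
  have h : ∀ n : ℕ, ∑ k ∈ Finset.range (n + 1), ((k : ℝ) + 1) ^ (-1.4 : ℝ) ≤
      3.5 - 2.5 * ((n : ℝ) + 1) ^ (-0.4 : ℝ) := by
    intro n
    induction n with
    | zero => norm_num
    | succ n ih =>
      rw [Finset.sum_range_succ]
      have := rpow_telescope n
      push_cast
      rw [show (n : ℝ) + 1 + 1 = n + 2 by ring]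
      linarith
  cases n with
  | zero => norm_num
  | succ n =>
    refine (h n).trans ?_
    have : (0 : ℝ) ≤ ((n : ℝ) + 1) ^ (-0.4 : ℝ) := by positivity
    linarith

lemma log_two_rpow_le : (Real.log 2) ^ (-1.4 : ℝ) ≤ 2.5 := by
  have h1 : (0.69 : ℝ) ≤ Real.log 2 := by linarith [Real.log_two_gt_d9]
  have h2 : Real.log 2 ≤ 1 := by linarith [Real.log_two_lt_d9]
  calc (Real.log 2) ^ (-1.4 : ℝ) ≤ (Real.log 2) ^ (-2 : ℝ) :=
        Real.rpow_le_rpow_of_exponent_ge (by linarith) h2 (by norm_num)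
    _ = ((Real.log 2) ^ 2)⁻¹ := by
        rw [Real.rpow_neg (by linarith)]; norm_num
    _ ≤ ((0.69 : ℝ) ^ 2)⁻¹ := by gcongr
    _ ≤ 2.5 := by norm_num

lemma sum_exp_neg_epochCost_le {δ : ℝ} (hδ : 0 < δ) (n : ℕ) :
    ∑ k ∈ Finset.range n, Real.exp (-epochCost δ k) ≤ δ := by
  simp_rw [exp_neg_epochCost hδ, ← Finset.mul_sum]
  have h1 := sum_rpow_le n
  have h2 := log_two_rpow_le
  have h3 : (0 : ℝ) ≤ (Real.log 2) ^ (-1.4 : ℝ) :=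
    Real.rpow_nonneg (Real.log_nonneg (by norm_num)) _
  -- The 10 in log(10/δ) absorbs 2.5 · 3.5 = 8.75.
  calc δ / 10 * (Real.log 2) ^ (-1.4 : ℝ) * ∑ k ∈ Finset.range n, ((k : ℝ) + 1) ^ (-1.4 : ℝ)
      ≤ δ / 10 * 2.5 * 3.5 := by gcongr
    _ ≤ δ := by linarith

/-- The iterated logarithm is negative at k = 0, so positivity is read off from the sum bound: each
exp(-cost) is at most δ < 1. -/
lemma epochCost_pos {δ : ℝ} (hδ : 0 < δ) (hδ1 : δ < 1) (k : ℕ) : 0 < epochCost δ k := by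
  have h0 := sum_exp_neg_epochCost_le hδ (k + 1)
  have h1 : Real.exp (-epochCost δ k) ≤ ∑ j ∈ Finset.range (k + 1), Real.exp (-epochCost δ j) :=
    Finset.single_le_sum (f := fun j => Real.exp (-epochCost δ j))
      (fun j _ => (Real.exp_pos _).le) (Finset.self_mem_range_succ k)
  have h2 : Real.exp (-epochCost δ k) < 1 := by linarith
  rw [Real.exp_lt_one_iff] at h2
  linarith

lemma epochCost_le {δ : ℝ} {k t : ℕ} (hk : 4 ^ k ≤ t) : epochCost δ k ≤ t * ell δ t := by
  have ht : (4 : ℝ) ^ k ≤ t := by exact_mod_cast hk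
  have h4 : (0 : ℝ) < 4 ^ k := by positivity
  have ht0 : (0 : ℝ) < t := h4.trans_le ht
  have h2 : 0 < Real.log 2 := Real.log_pos (by norm_num)
  rw [ell, mul_div_cancel₀ _ ht0.ne', epochCost]
  have hlog : ((k : ℝ) + 1) * Real.log 2 ≤ Real.log (2.1 * t) := by
    have : ((k : ℝ) + 1) * Real.log 2 = Real.log (2 ^ (k + 1)) := by
      rw [Real.log_pow]; push_cast; ring
    rw [this]
    refine Real.log_le_log (by positivity) ?_
    calc (2 : ℝ) ^ (k + 1) = 2 * 2 ^ k := by ring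
      _ ≤ 2 * 4 ^ k := by gcongr; norm_num
      _ ≤ 2 * t := by gcongr
      _ ≤ 2.1 * t := by gcongr; norm_num
  have := Real.log_le_log (by positivity) hlog
  linarith

/-- Transfers a deviation bound at the fixed cost of an epoch to the boundary u_t at each of its
times. -/
lemma le_mul_u {α δ : ℝ} (hα : 0 ≤ α * (1 - α)) {t : ℕ} {x : ℝ} (hx : 0 ≤ x)
    (h : x ≤ t * ell δ t) :
    1.5 * Real.sqrt (α * (1 - α) * t * x) + 0.8 * x ≤ t * u α δ t := by
  have h1 : Real.sqrt (α * (1 - α) * t * x) ≤ t * Real.sqrt (α * (1 - α) * ell δ t) := by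
    rw [Real.sqrt_le_left (by positivity)]
    rcases Nat.eq_zero_or_pos t with h0 | h0
    · simp [h0]
    have ht : (0 : ℝ) < t := by exact_mod_cast h0
    have hl : 0 ≤ ell δ t := by
      by_contra hn
      push Not at hn
      nlinarith [mul_neg_of_pos_of_neg ht hn]
    rw [mul_pow, Real.sq_sqrt (by positivity)]
    calc α * (1 - α) * t * x ≤ α * (1 - α) * t * (t * ell δ t) := by gcongr
      _ = _ := by ring
  rw [u]
  linarith

end SplitTUPAC
namespace SplitTUPAC

/-! ### Ville's inequality for products of independent variables. -/

section Ville
variable {Ω : Type*} [MeasurableSpace Ω] {P : Measure Ω} [IsProbabilityMeasure P]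

/-- Partial products of independent bounded variables of mean one form a martingale. -/
lemma martingale_prod {X : ℕ → Ω → ℝ} {C : ℝ} (hX : ∀ i, StronglyMeasurable (X i))
    (hind : iIndepFun X P) (h0 : ∀ i ω, 0 ≤ X i ω) (hC : ∀ i ω, X i ω ≤ C)
    (hmean : ∀ i, ∫ ω, X i ω ∂P = 1) :
    Martingale (fun n ω => ∏ i ∈ Finset.range (n + 1), X i ω) (Filtration.natural X hX) P := by
  have hadp : StronglyAdapted (Filtration.natural X hX)
      (fun n ω => ∏ i ∈ Finset.range (n + 1), X i ω) := by
    intro n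
    refine Finset.stronglyMeasurable_fun_prod _ fun i hi => ?_
    exact (Filtration.stronglyAdapted_natural hX i).mono
      ((Filtration.natural X hX).mono (Nat.lt_succ_iff.1 (Finset.mem_range.1 hi)))
  have hmeas : ∀ n, StronglyMeasurable (fun ω => ∏ i ∈ Finset.range (n + 1), X i ω) := fun n =>
    (hadp n).mono ((Filtration.natural X hX).le n)
  have hint : ∀ n, Integrable (fun ω => ∏ i ∈ Finset.range (n + 1), X i ω) P := by
    intro n
    refine Integrable.of_bound (hmeas n).aestronglyMeasurable (C ^ (n + 1)) (.of_forall fun ω => ?_)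
    rw [Real.norm_of_nonneg (Finset.prod_nonneg fun i _ => h0 i ω)]
    calc ∏ i ∈ Finset.range (n + 1), X i ω ≤ ∏ _i ∈ Finset.range (n + 1), C :=
          Finset.prod_le_prod (fun i _ => h0 i ω) (fun i _ => hC i ω)
      _ = _ := by simp
  have hXint : ∀ n, Integrable (X n) P := fun n =>
    Integrable.of_bound (hX n).aestronglyMeasurable C
      (.of_forall fun ω => by rw [Real.norm_of_nonneg (h0 n ω)]; exact hC n ω)
  refine martingale_nat hadp hint fun n => ?_
  have e : (fun ω => ∏ i ∈ Finset.range (n + 1 + 1), X i ω) =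
      (fun ω => ∏ i ∈ Finset.range (n + 1), X i ω) * X (n + 1) := by
    ext ω
    simp [Finset.prod_range_succ _ (n + 1)]
  have hpull := condExp_mul_of_stronglyMeasurable_left (μ := P) (hadp n)
    (by rw [← e]; exact hint (n + 1)) (hXint (n + 1))
  rw [← e] at hpull
  have hone := hind.condExp_natural_ae_eq_of_lt hX (Nat.lt_succ_self n)
  filter_upwards [hpull, hone] with ω h1 h2
  rw [h1, Pi.mul_apply, h2, hmean, mul_one]

lemma measure_exists_le_prod {X : ℕ → Ω → ℝ} {C : ℝ} (hX : ∀ i, StronglyMeasurable (X i))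
    (hind : iIndepFun X P) (h0 : ∀ i ω, 0 ≤ X i ω) (hC : ∀ i ω, X i ω ≤ C)
    (hmean : ∀ i, ∫ ω, X i ω ∂P = 1) (x : ℝ) (N : ℕ) :
    P {ω | ∃ t, 1 ≤ t ∧ t ≤ N ∧ Real.exp x ≤ ∏ i ∈ Finset.range t, X i ω} ≤
      ENNReal.ofReal (Real.exp (-x)) := by
  have hM := martingale_prod hX hind h0 hC hmean
  have hnn : 0 ≤ fun (n : ℕ) ω => ∏ i ∈ Finset.range (n + 1), X i ω :=
    fun n ω => Finset.prod_nonneg fun i _ => h0 i ω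
  have hmax := maximal_ineq hM.submartingale hnn (ε := ⟨Real.exp x, (Real.exp_pos x).le⟩) N
  have hint1 : ∫ ω, (∏ i ∈ Finset.range (N + 1), X i ω) ∂P = 1 := by
    have := hM.setIntegral_eq (Nat.zero_le N) MeasurableSet.univ
    simp only [Measure.restrict_univ, zero_add, Finset.range_one, Finset.prod_singleton] at this
    rw [← this, hmean]
  have hle := hmax.trans (ENNReal.ofReal_le_ofReal
    ((setIntegral_le_integral (hM.integrable N) (.of_forall fun ω => hnn N ω)).trans hint1.le))
  have hsub : {ω | ∃ t, 1 ≤ t ∧ t ≤ N ∧ Real.exp x ≤ ∏ i ∈ Finset.range t, X i ω} ⊆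
      {ω | Real.exp x ≤ (Finset.range (N + 1)).sup' Finset.nonempty_range_add_one
        fun k => ∏ i ∈ Finset.range (k + 1), X i ω} := by
    rintro ω ⟨t, ht1, htN, ht⟩
    -- The martingale at index s has s + 1 factors.
    obtain ⟨s, rfl⟩ := Nat.exists_eq_add_of_le' ht1
    exact ht.trans (Finset.le_sup' (fun k => ∏ i ∈ Finset.range (k + 1), X i ω)
      (Finset.mem_range.2 (by omega)))
  refine (measure_mono hsub).trans ?_
  rw [Real.exp_neg, ENNReal.ofReal_inv_of_pos (Real.exp_pos x), ENNReal.le_inv_iff_mul_le]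
  rw [ENNReal.ofReal_one] at hle
  rw [mul_comm, ENNReal.ofReal_eq_coe_nnreal (Real.exp_pos x).le]
  exact hle

end Ville

/-! ### Time-uniform bound on the number of hits. -/

section Crossing
variable {Ω 𝒵 : Type*} [MeasurableSpace Ω] [MeasurableSpace 𝒵] {P : Measure Ω}
  [IsProbabilityMeasure P] {Z : ℕ → Ω → 𝒵}

/-- The number of observations in `S` among the first `t`. -/
noncomputable def hits (Z : ℕ → Ω → 𝒵) (S : Set 𝒵) (t : ℕ) (ω : Ω) : ℝ :=
  ∑ i ∈ Finset.range t, S.indicator (fun _ => (1 : ℝ)) (Z i ω)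

lemma integral_exp_indicator (hZ : ∀ i, Measurable (Z i)) {S : Set 𝒵} (hS : MeasurableSet S)
    (l : ℝ) (i : ℕ) :
    ∫ ω, Real.exp (l * S.indicator (fun _ => (1 : ℝ)) (Z i ω)) ∂P =
      1 - P.real (Z i ⁻¹' S) + P.real (Z i ⁻¹' S) * Real.exp l := by
  have h : (fun ω => Real.exp (l * S.indicator (fun _ => (1 : ℝ)) (Z i ω))) =
      fun ω => 1 + (Z i ⁻¹' S).indicator (fun _ => Real.exp l - 1) ω := by
    ext ω
    by_cases hω : Z i ω ∈ S
    · rw [Set.indicator_of_mem hω, Set.indicator_of_mem (Set.mem_preimage.2 hω)]; simp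
    · rw [Set.indicator_of_notMem hω, Set.indicator_of_notMem (by simpa using hω)]; simp
  have hm : MeasurableSet (Z i ⁻¹' S) := hZ i hS
  rw [h, integral_add (integrable_const _) ((integrable_const _).indicator hm),
    integral_indicator_const _ hm]
  simp
  ring

/-- Ville's inequality for the likelihood process of the hits of `S`. -/
lemma measure_exists_hits_ge (hZ : ∀ i, Measurable (Z i)) (hind : iIndepFun Z P) {S : Set 𝒵}
    (hS : MeasurableSet S) {q l : ℝ} (hq0 : 0 ≤ q) (hq1 : q ≤ 1)
    (hp : ∀ i, P.real (Z i ⁻¹' S) ≤ q) (hpp : ∀ i, P.real (Z i ⁻¹' S) = P.real (Z 0 ⁻¹' S))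
    (hl0 : 0 ≤ l) (hl1 : l < 5 / 4) (x : ℝ) (N : ℕ) :
    P {ω | ∃ t : ℕ, 1 ≤ t ∧ t ≤ N ∧
        x + t * ((1 - q) * q * (l ^ 2 / (2 * (1 - 0.8 * l)))) ≤ l * (hits Z S t ω - t * q)} ≤
      ENNReal.ofReal (Real.exp (-x)) := by
  set p := P.real (Z 0 ⁻¹' S) with hpdef
  set m := 1 - p + p * Real.exp l with hm
  have hp0 : 0 ≤ p := measureReal_nonneg
  have hexp1 : 1 ≤ Real.exp l := Real.one_le_exp hl0
  have hm1 : 1 ≤ m := by rw [hm]; nlinarith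
  have hm0 : 0 < m := by linarith
  set B := l * q + (1 - q) * q * (l ^ 2 / (2 * (1 - 0.8 * l))) with hB
  -- The true hit probability may be below `q` if the score law has an atom. Dividing by the true
  -- `m` keeps mean one, and monotonicity in the probability passes to `q`.
  have hmB : m ≤ Real.exp B := by
    refine le_trans ?_ (bernoulli_mgf_le hq0 hq1 hl0 hl1)
    have := hp 0
    rw [hm]; nlinarith
  set f : 𝒵 → ℝ := fun z => Real.exp (l * S.indicator (fun _ => (1 : ℝ)) z) / m with hf
  have hfm : Measurable f :=
    (((measurable_const.indicator hS).const_mul l).exp).div_const m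
  have hfC : ∀ z, f z ≤ Real.exp l := by
    intro z
    rw [hf]
    refine (div_le_self (Real.exp_pos _).le hm1).trans (Real.exp_le_exp.2 ?_)
    have : S.indicator (fun _ => (1 : ℝ)) z ≤ 1 := Set.indicator_le_self' (by simp) z
    nlinarith
  have hV := measure_exists_le_prod (P := P) (X := fun i => f ∘ Z i) (C := Real.exp l)
    (fun i => (hfm.comp (hZ i)).stronglyMeasurable) (hind.comp (fun _ => f) fun _ => hfm)
    (fun i ω => by simp only [hf, Function.comp]; positivity) (fun i ω => hfC _)
    (fun i => by
      simp only [hf, Function.comp]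
      rw [integral_div, integral_exp_indicator hZ hS, hpp i, div_self hm0.ne']) x N
  refine (measure_mono ?_).trans hV
  rintro ω ⟨t, ht1, htN, ht⟩
  refine ⟨t, ht1, htN, ?_⟩
  simp only [hf, Function.comp]
  rw [Finset.prod_div_distrib, ← Real.exp_sum, ← Finset.mul_sum, Finset.prod_const,
    Finset.card_range, le_div_iff₀ (by positivity)]
  calc Real.exp x * m ^ t ≤ Real.exp x * Real.exp B ^ t := by gcongr
    _ = Real.exp (x + t * B) := by rw [← Real.exp_nat_mul, ← Real.exp_add]
    _ ≤ Real.exp (l * hits Z S t ω) := by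
        apply Real.exp_le_exp.2
        rw [hB]
        linarith

/-- With probability at least `1 - δ` the frequency of hits stays below `1 - α + u_t` forever. -/
lemma measure_exists_crossing_le (hZ : ∀ i, Measurable (Z i)) (hind : iIndepFun Z P) {S : Set 𝒵}
    (hS : MeasurableSet S) {α δ : ℝ} (hα : α ∈ Set.Ioo (0 : ℝ) 1) (hδ : δ ∈ Set.Ioo (0 : ℝ) 1)
    (hp : ∀ i, P.real (Z i ⁻¹' S) ≤ 1 - α)
    (hpp : ∀ i, P.real (Z i ⁻¹' S) = P.real (Z 0 ⁻¹' S)) :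
    P {ω | ∃ t : ℕ, 1 ≤ t ∧ t * (1 - α + u α δ t) ≤ hits Z S t ω} ≤ ENNReal.ofReal δ := by
  have hv : 0 < α * (1 - α) := mul_pos hα.1 (sub_pos.2 hα.2)
  let A : ℕ → Set Ω := fun k =>
    {ω | ∃ t : ℕ, 4 ^ k ≤ t ∧ t ≤ 4 ^ (k + 1) ∧ t * (1 - α + u α δ t) ≤ hits Z S t ω}
  have hA : ∀ k, P (A k) ≤ ENNReal.ofReal (Real.exp (-epochCost δ k)) := by
    intro k
    have hx := epochCost_pos hδ.1 hδ.2 k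
    obtain ⟨l, hl0, hl1, hl⟩ := exists_exponent hv hx (m := 4 ^ k) (by positivity)
    refine (measure_mono ?_).trans (measure_exists_hits_ge hZ hind hS
      (sub_nonneg.2 hα.2.le) (by linarith [hα.1]) hp hpp hl0.le hl1 (epochCost δ k) (4 ^ (k + 1)))
    rintro ω ⟨t, ht1, ht2, ht⟩
    refine ⟨t, Nat.one_le_pow _ _ (by norm_num) |>.trans ht1, ht2, ?_⟩
    have h1 := hl t (by exact_mod_cast ht1) (by rw [mul_comm, ← pow_succ]; exact_mod_cast ht2)
    have h2 := le_mul_u hv.le hx.le (epochCost_le (δ := δ) ht1)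
    have h3 := mul_le_mul_of_nonneg_left (h2.trans (show t * u α δ t ≤
      hits Z S t ω - t * (1 - α) by linarith)) hl0.le
    rw [show (1 - (1 - α)) = α by ring]
    exact h1.trans h3
  have hsub : {ω | ∃ t : ℕ, 1 ≤ t ∧ t * (1 - α + u α δ t) ≤ hits Z S t ω} ⊆ ⋃ k, A k := by
    rintro ω ⟨t, ht1, ht⟩
    exact Set.mem_iUnion.2 ⟨Nat.log 4 t, t, Nat.pow_log_le_self 4 (by omega),
      (Nat.lt_pow_succ_log_self (by norm_num) t).le, ht⟩
  refine (measure_mono hsub).trans ((measure_iUnion_le A).trans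
    ((ENNReal.tsum_le_tsum hA).trans ?_))
  refine ENNReal.tsum_le_of_sum_range_le fun n => ?_
  rw [← ENNReal.ofReal_sum_of_nonneg fun k _ => (Real.exp_pos _).le]
  exact ENNReal.ofReal_le_ofReal (sum_exp_neg_epochCost_le hδ.1 n)

end Crossing
end SplitTUPAC
namespace SplitTUPAC

/-! ### Quantiles and the empirical threshold. -/

/-- The `q`-quantile of a probability measure on the line. -/
lemma exists_quantile (μ : Measure ℝ) [IsProbabilityMeasure μ] {q : ℝ} (hq0 : 0 < q)
    (hq1 : q < 1) : ∃ r : ℝ, q ≤ μ.real (Set.Iic r) ∧ μ.real (Set.Iio r) ≤ q := by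
  set A := {r : ℝ | q ≤ cdf μ r} with hA
  obtain ⟨b, hb⟩ := ((tendsto_cdf_atTop μ).eventually (lt_mem_nhds hq1)).exists
  obtain ⟨a, ha⟩ := ((tendsto_cdf_atBot μ).eventually (gt_mem_nhds hq0)).exists
  have hbdd : BddBelow A := ⟨a, fun r hr => le_of_not_gt fun h =>
    absurd ((show q ≤ cdf μ r from hr).trans (monotone_cdf μ h.le)) (not_le.2 ha)⟩
  have hne : A.Nonempty := ⟨b, hb.le⟩
  refine ⟨sInf A, ?_, ?_⟩
  · rw [← cdf_eq_real]
    have hc := ((cdf μ).right_continuous (sInf A)).mono Set.Ioi_subset_Ici_self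
    refine ge_of_tendsto hc (eventually_nhdsWithin_of_forall fun r hr => ?_)
    obtain ⟨s, hs, hsr⟩ := exists_lt_of_csInf_lt hne hr
    exact (show q ≤ cdf μ s from hs).trans (monotone_cdf μ hsr.le)
  · have hlim := (cdf μ).mono.tendsto_leftLim (sInf A)
    have h1 : Function.leftLim (cdf μ) (sInf A) ≤ q :=
      le_of_tendsto hlim (eventually_nhdsWithin_of_forall fun r hr =>
        (le_of_not_ge fun h => absurd (csInf_le hbdd h) (not_le.2 hr)))
    have h2 := (cdf μ).measure_Iio (tendsto_cdf_atBot μ) (sInf A)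
    rw [measure_cdf, sub_zero] at h2
    rw [measureReal_def, h2]
    exact ENNReal.toReal_le_of_le_ofReal hq0.le (ENNReal.ofReal_le_ofReal h1)

section Deterministic
variable {𝒵 : Type*} {R : 𝒵 → ℝ} {α δ : ℝ} {t : ℕ}

lemma empCDF_mono (z : Fin t → 𝒵) : Monotone (empCDF R t z) := by
  intro r s hrs
  unfold empCDF
  refine div_le_div_of_nonneg_right (Finset.sum_le_sum fun i _ => ?_) (Nat.cast_nonneg t)
  exact Set.indicator_le_indicator_of_subset (fun x (hx : R x ≤ r) => hx.trans hrs)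
    (fun _ => zero_le_one) _

/-- A rational witness makes the event a countable union, hence measurable, and also covers the
infinite values of q̂_t. -/
lemma qHat_lt_iff (z : Fin t → 𝒵) (y : ℝ) :
    qHat α δ R t z < y ↔ ∃ s : ℚ, (s : ℝ) < y ∧ 1 - α + u α δ t ≤ empCDF R t z s := by
  unfold qHat
  rw [sInf_lt_iff]
  constructor
  · rintro ⟨_, ⟨r, hr, rfl⟩, hry⟩
    obtain ⟨s, hs1, hs2⟩ := exists_rat_btwn (EReal.coe_lt_coe_iff.1 hry)
    exact ⟨s, hs2, le_trans hr (empCDF_mono z hs1.le)⟩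
  · rintro ⟨s, hs1, hs2⟩
    exact ⟨_, ⟨(s : ℝ), hs2, rfl⟩, EReal.coe_lt_coe_iff.2 hs1⟩

lemma measurable_empCDF [MeasurableSpace 𝒵] (hR : Measurable R) (r : ℝ) :
    Measurable fun z : Fin t → 𝒵 => empCDF R t z r := by
  unfold empCDF
  refine (Finset.measurable_fun_sum _ fun i _ => ?_).div_const _
  exact (measurable_const.indicator (hR measurableSet_Iic)).comp (measurable_pi_apply i)

lemma measurableSet_qHat_lt [MeasurableSpace 𝒵] (hR : Measurable R) {β : Type*}
    [MeasurableSpace β] {f : β → Fin t → 𝒵} {g : β → ℝ} (hf : Measurable f) (hg : Measurable g) :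
    MeasurableSet {b | qHat α δ R t (f b) < (g b : EReal)} := by
  simp_rw [qHat_lt_iff, Set.ofPred_exists]
  refine MeasurableSet.iUnion fun s => ?_
  exact (measurableSet_lt measurable_const hg).inter
    (measurableSet_le measurable_const ((measurable_empCDF hR s).comp hf))

/-- If q̂_t < q₀, the level is already reached at some s < q₀, and {R ≤ s} lies in {R < q₀}. This is
why the strict sublevel set is counted. -/
lemma le_qHat_of_hits_lt {Ω : Type*} {Z : ℕ → Ω → 𝒵} {ω : Ω} {q₀ : ℝ} (ht : 1 ≤ t)
    (h : hits Z {x | R x < q₀} t ω < t * (1 - α + u α δ t)) :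
    (q₀ : EReal) ≤ qHat α δ R t (fun i => Z i ω) := by
  by_contra hlt
  rw [not_le, qHat_lt_iff] at hlt
  obtain ⟨s, hs, hle⟩ := hlt
  refine absurd h (not_lt.2 ?_)
  have ht0 : (0 : ℝ) < t := by exact_mod_cast ht
  unfold empCDF at hle
  rw [le_div_iff₀ ht0, mul_comm] at hle
  refine hle.trans ?_
  rw [hits, Finset.sum_range]
  refine Finset.sum_le_sum fun i _ => ?_
  exact Set.indicator_le_indicator_of_subset (fun x (hx : R x ≤ s) => hx.trans_lt hs)
    (fun _ => zero_le_one) _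

end Deterministic

/-! ### Conditioning on the observed vector of random length. -/

section Observed
variable {Ω 𝒵 : Type*} [MeasurableSpace Ω] [MeasurableSpace 𝒵]

/-- The first `T` terms of a stream, as a function of the stream and of `T`. -/
def truncate (p : (ℕ → 𝒵) × ℕ) : Σ t : ℕ, (Fin t → 𝒵) := ⟨p.2, fun i => p.1 i⟩

lemma measurable_truncate : Measurable (truncate : (ℕ → 𝒵) × ℕ → Σ t : ℕ, (Fin t → 𝒵)) := by
  refine measurable_from_prod_countable_left fun t => ?_
  have h1 : Measurable (Sigma.mk (β := fun t : ℕ => Fin t → 𝒵) t) :=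
    fun s hs => MeasurableSpace.measurableSet_iInf.1 hs t
  exact h1.comp (measurable_pi_lambda _ fun i => measurable_pi_apply _)

lemma measurableSet_sigma {s : Set (Σ t : ℕ, (Fin t → 𝒵))}
    (h : ∀ t, MeasurableSet (Sigma.mk t ⁻¹' s)) : MeasurableSet s :=
  MeasurableSpace.measurableSet_iInf.2 h

variable {P : Measure Ω} [IsProbabilityMeasure P] {Z : ℕ → Ω → 𝒵} {Ztest : Ω → 𝒵} {R : 𝒵 → ℝ}
  {α δ : ℝ} {T : Ω → ℕ}

lemma measurable_observed (hZ : ∀ i, Measurable (Z i)) (hT : Measurable T) :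
    Measurable (observed Z T) :=
  measurable_truncate.comp ((measurable_pi_lambda _ hZ).prodMk hT)

lemma measurableSet_test_mem (hZ : ∀ i, Measurable (Z i)) (hZtest : Measurable Ztest)
    (hR : Measurable R) (hT : Measurable T) :
    MeasurableSet {ω | Ztest ω ∈ predSet α δ R (T ω) (fun i => Z i ω)} := by
  have h : {ω | Ztest ω ∈ predSet α δ R (T ω) (fun i => Z i ω)} =
      ⋃ t, (T ⁻¹' {t} ∩ {ω | qHat α δ R t (fun i => Z i ω) < (R (Ztest ω) : EReal)}ᶜ) := by
    ext ω
    simp [predSet]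
  rw [h]
  refine MeasurableSet.iUnion fun t => (hT (measurableSet_singleton t)).inter
    (MeasurableSet.compl ?_)
  exact measurableSet_qHat_lt hR (measurable_pi_lambda _ fun i => hZ i) (hR.comp hZtest)

/-- Where the reported threshold is at least `q₀`, the conditional coverage is at least the
probability of a score of at most `q₀`. -/
lemma coverage_le_condExp (hZ : ∀ i, Measurable (Z i)) (hZtest : Measurable Ztest)
    (hR : Measurable R) (hT : Measurable T)
    (hTind : IndepFun Ztest (fun ω => ((fun i : ℕ => Z i ω), T ω)) P) (q₀ : ℝ) :
    ∀ᵐ ω ∂P, (q₀ : EReal) ≤ qHat α δ R (T ω) (fun i => Z i ω) →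
      P.real (Ztest ⁻¹' {x | R x ≤ q₀}) ≤
      (P[Set.indicator {ω' : Ω | Ztest ω' ∈ predSet α δ R (T ω') (fun i => Z i ω')}
          (fun _ => (1 : ℝ)) | MeasurableSpace.comap (observed Z T) inferInstance]) ω := by
  have hmle := (measurable_observed hZ hT).comap_le
  set E := {ω | (q₀ : EReal) ≤ qHat α δ R (T ω) (fun i => Z i ω)} with hE
  set D := Ztest ⁻¹' {x | R x ≤ q₀} with hD
  have hS : MeasurableSet {x | R x ≤ q₀} := hR measurableSet_Iic
  have hDm : MeasurableSet D := hZtest hS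
  have hEm : MeasurableSet[MeasurableSpace.comap (observed Z T) inferInstance] E := by
    refine ⟨{p | (q₀ : EReal) ≤ qHat α δ R p.1 p.2}, measurableSet_sigma fun t => ?_, rfl⟩
    have := (measurableSet_qHat_lt (α := α) (δ := δ) (t := t) hR measurable_id
      (measurable_const (a := q₀))).compl
    convert this using 1
    ext z
    simp
  have hDint : Integrable (D.indicator fun _ => (1 : ℝ)) P := (integrable_const 1).indicator hDm
  have hcov : Integrable (Set.indicator {ω' : Ω | Ztest ω' ∈ predSet α δ R (T ω')
      (fun i => Z i ω')} (fun _ => (1 : ℝ))) P :=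
    (integrable_const 1).indicator (measurableSet_test_mem hZ hZtest hR hT)
  -- E ∩ D lies in the coverage event; `E` is observable and factors out, while `D` is independent
  -- of the observations.
  have hmono : P[E.indicator (D.indicator fun _ => (1 : ℝ)) |
      MeasurableSpace.comap (observed Z T) inferInstance] ≤ᵐ[P] P[Set.indicator
      {ω' : Ω | Ztest ω' ∈ predSet α δ R (T ω') (fun i => Z i ω')} (fun _ => (1 : ℝ)) |
      MeasurableSpace.comap (observed Z T) inferInstance] := by
    refine condExp_mono (hDint.indicator (hmle _ hEm)) hcov (.of_forall fun ω => ?_)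
    rw [Set.indicator_indicator]
    refine Set.indicator_le_indicator_of_subset ?_ (fun _ => zero_le_one) ω
    rintro ω' ⟨h1, h2⟩
    exact (EReal.coe_le_coe_iff.2 (show R (Ztest ω') ≤ q₀ from h2)).trans h1
  have hind : P[D.indicator (fun _ => (1 : ℝ)) |
      MeasurableSpace.comap (observed Z T) inferInstance] =ᵐ[P] fun _ => P.real D := by
    have hI : Indep (MeasurableSpace.comap Ztest inferInstance)
        (MeasurableSpace.comap (observed Z T) inferInstance) P :=
      hTind.comp measurable_id measurable_truncate
    have := condExp_indep_eq (f := D.indicator fun _ => (1 : ℝ)) hZtest.comap_le hmle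
      (stronglyMeasurable_const.indicator ⟨_, hS, rfl⟩) hI
    simpa [integral_indicator_const _ hDm] using this
  filter_upwards [hmono, condExp_indicator hDint hEm, hind] with ω h1 h2 h3 hω
  rw [h2, Set.indicator_of_mem (show ω ∈ E from hω), h3] at h1
  exact h1

end Observed
end SplitTUPAC

theorem mainTheorem5 {Ω 𝒵 : Type*} [MeasurableSpace Ω] [MeasurableSpace 𝒵]
    (P : Measure Ω) [IsProbabilityMeasure P]
    (Z : ℕ → Ω → 𝒵) (Ztest : Ω → 𝒵)
    (hZ : ∀ i, Measurable (Z i)) (hZtest : Measurable Ztest)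
    (hindep : iIndepFun Z P)
    (hident : ∀ i, IdentDistrib (Z i) Ztest P P)
    (htest : IndepFun Ztest (fun ω => (fun i : ℕ => Z i ω)) P)
    (R : 𝒵 → ℝ) (hR : Measurable R)
    (α δ : ℝ) (hα : α ∈ Set.Ioo (0 : ℝ) 1) (hδ : δ ∈ Set.Ioo (0 : ℝ) 1) :
    SplitTUPAC.IsTUPAC P Z Ztest (SplitTUPAC.predSet α δ R) α δ := by
  intro T hT hT1 hTind
  have hRZ : Measurable fun ω => R (Ztest ω) := hR.comp hZtest
  have : IsProbabilityMeasure (P.map fun ω => R (Ztest ω)) :=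
    Measure.isProbabilityMeasure_map hRZ.aemeasurable
  obtain ⟨q₀, hq1, hq2⟩ := SplitTUPAC.exists_quantile (P.map fun ω => R (Ztest ω))
    (sub_pos.2 hα.2) (by linarith [hα.1] : 1 - α < 1)
  rw [map_measureReal_apply hRZ measurableSet_Iic] at hq1
  rw [map_measureReal_apply hRZ measurableSet_Iio] at hq2
  have hS : MeasurableSet {x | R x < q₀} := hR measurableSet_Iio
  have hp : ∀ i, P.real (Z i ⁻¹' {x | R x < q₀}) = P.real (Ztest ⁻¹' {x | R x < q₀}) := fun i => by
    rw [measureReal_def, (hident i).measure_mem_eq hS, measureReal_def]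
  have hcross := SplitTUPAC.measure_exists_crossing_le hZ hindep hS hα hδ
    (fun i => (hp i).trans_le hq2) (fun i => (hp i).trans (hp 0).symm)
  set A := {ω | ∃ t : ℕ, 1 ≤ t ∧
    t * (1 - α + SplitTUPAC.u α δ t) ≤ SplitTUPAC.hits Z {x | R x < q₀} t ω} with hA
  have hA1 : P.real A ≤ δ := ENNReal.toReal_le_of_le_ofReal hδ.1.le hcross
  -- Subadditivity suffices, so measurability of `A` is not needed.
  have hA2 : 1 - δ ≤ P.real Aᶜ := by
    have := measureReal_union_le (μ := P) A Aᶜ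
    rw [Set.union_compl_self, probReal_univ] at this
    linarith
  refine hA2.trans (ENNReal.toReal_mono (measure_ne_top _ _) (measure_mono_ae ?_))
  filter_upwards [SplitTUPAC.coverage_le_condExp (α := α) (δ := δ) hZ hZtest hR hT hTind q₀]
    with ω hω hωA
  have hlt : SplitTUPAC.hits Z {x | R x < q₀} (T ω) ω <
      T ω * (1 - α + SplitTUPAC.u α δ (T ω)) := by
    by_contra h
    exact hωA ⟨T ω, hT1 ω, not_lt.1 h⟩
  exact hq1.trans (hω (SplitTUPAC.le_qHat_of_hits_lt (hT1 ω) hlt))
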